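/- Let $(\lambda_n)_{n\in\mathbb N}$ and $(\widetilde\lambda_n)_{n\in\mathbb N}$ be two sequences of positive real numbers with $\sum_n\lambda_n<\infty$ and $\sum_n\widetilde\lambda_n<\infty$, and let $\mathcal N(\lambda)=\#\{n:\lambda_n>\lambda\}$ and $\widetilde{\mathcal N}(\lambda)=\#\{n:\widetilde\lambda_n>\lambda\}$, $\lambda>0$, be their counting functions. Let $\xi_n$, $n\in\mathbb N$, be independent standard normal random variables on a probability space with probability $\mathbf P$. Suppose that $$\liminf_{x\to0+}\frac{\int_0^{hx}\mathcal N(\lambda)\,d\lambda}{\int_0^{x}\mathcal N(\lambda)\,d\lambda}>1\qquad\text{for every } h>1,$$ and that $\mathcal N(\lambda)\sim\widetilde{\mathcal N}(\lambda)$ as $\lambda\to0+$ (that is, the ratio tends to $1$). Then, as $r\to0+$, $$\ln\mathbf P\Big\{\sum_{n=1}^\infty\widetilde\lambda_n\xi_n^2\le r\Big\}\sim\ln\mathbf P\Big\{\sum_{n=1}^\infty\lambda_n\xi_n^2\le r\Big\}.$$ -/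

import Mathlib

open Filter Topology MeasureTheory ProbabilityTheory Asymptotics

noncomputable section

/-- The counting function `𝒩(x) = #{n : lam n > x}`, as a real number. For a positive summable
sequence and `x > 0` the set is finite; only values at `x > 0` are ever used. -/
def countingFunction (lam : ℕ → ℝ) (x : ℝ) : ℝ :=
  ({n : ℕ | x < lam n}.ncard : ℝ)

/-- The probability `P {∑ lam n * (ξ n)^2 ≤ r}` as a real number. The series of nonnegative terms
is summed in `[0, ∞]`, so that a divergent sum is never `≤ r`. -/
def smallBallProb {Ω : Type*} [MeasurableSpace Ω] (P : Measure Ω) (ξ : ℕ → Ω → ℝ)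
    (lam : ℕ → ℝ) (r : ℝ) : ℝ :=
  P.real {ω | ∑' n, ENNReal.ofReal (lam n * ξ n ω ^ 2) ≤ ENNReal.ofReal r}

end

/-! ### Log-Laplace transform of the partial sums and its derivatives -/

section LaplaceTransform

/-! Write `L`, `A` for `logSum lam`, `ratioSum lam`, and `L'`, `A'` for those of `lam'`. At `r =
A(s)/s`, the mean of the `lam` sum tilted by `-s/2`, both log-probabilities are shown to be
equivalent to `-J(s)`, where `J = L - A/2`.

Upper bound: Chernoff at `s` gives the exponent `A(s)/2 - L'(s)` for `lam'`. Lower bound: tilt at `h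
* s` with `h` slightly above 1; the tilted mean drops below `r` by a fixed factor, so Chebyshev
keeps most of the tilted mass below `r`, at an extra cost of order `√A'(h * s)`
(`le_smallBallProb`).

Equivalent counting functions give `L' ~ L` and `A' ~ A` (`IsSlowProfile.isEquivalent`), because
truncated sums are integrals of counting functions and the finitely many large terms are negligible.

All errors are small relative to `L`, so cancellation in `J` must be excluded. Regularity with ratio
2 yields `B ≥ c * A` for `B = ∑ (s * lam n / (1 + s * lam n)) ^ 2`. This bounds `L` by a multiple of
`J` (`tsum_ratio_sq_le`) and also produces the drop of the tilted mean (`ratioSum_mul_le`). Finally,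
every small `r` is a tilted mean at some large `s`. -/

theorem integral_exp_neg_mul_sq_gaussianReal {b : ℝ} :
    ∫ x, Real.exp (-b * x ^ 2) ∂(gaussianReal 0 1) = (√(1 + 2 * b))⁻¹ := by
  rw [integral_gaussianReal_eq_integral_smul one_ne_zero]
  have h : ∀ x : ℝ, gaussianPDFReal 0 1 x • Real.exp (-b * x ^ 2)
      = (√(2 * Real.pi))⁻¹ * Real.exp (-(1 / 2 + b) * x ^ 2) := by
    intro x
    simp only [gaussianPDFReal, smul_eq_mul, NNReal.coe_one, mul_one, sub_zero, mul_assoc]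
    rw [← Real.exp_add]
    congr 2
    ring
  simp_rw [h]
  rw [integral_const_mul, integral_gaussian, ← Real.sqrt_inv, ← Real.sqrt_inv, ← Real.sqrt_mul
    (by positivity)]
  congr 1
  have : (1 / 2 + b) = (1 + 2 * b) / 2 := by ring
  rw [this]
  have := Real.pi_ne_zero
  -- Here both sides vanish since division by zero gives zero.
  by_cases hb : 1 + 2 * b = 0
  · simp [hb]
  · field_simp

variable {Ω : Type*} [MeasurableSpace Ω] {P : Measure Ω}

theorem integrable_exp_mul_of_nonpos [IsFiniteMeasure P] {X : Ω → ℝ} (hX : AEMeasurable X P)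
    (h0 : ∀ ω, 0 ≤ X ω) {t : ℝ} (ht : t ≤ 0) : Integrable (fun ω => Real.exp (t * X ω)) P := by
  refine Integrable.of_bound (C := 1) (by fun_prop) (ae_of_all _ fun ω => ?_)
  rw [Real.norm_eq_abs, Real.abs_exp, Real.exp_le_one_iff]
  exact mul_nonpos_of_nonpos_of_nonneg ht (h0 ω)

theorem cgf_mul_sq_of_hasLaw_gaussianReal {ξ : Ω → ℝ} (hξ : HasLaw ξ (gaussianReal 0 1) P)
    {c t : ℝ} (h : 0 ≤ 1 - 2 * t * c) :
    cgf (fun ω => c * ξ ω ^ 2) P t = -(Real.log (1 - 2 * t * c) / 2) := by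
  have h1 : ∫ ω, Real.exp (t * (c * ξ ω ^ 2)) ∂P
      = ∫ x, Real.exp (-(-(t * c)) * x ^ 2) ∂(gaussianReal 0 1) := by
    rw [← hξ.map_eq, integral_map hξ.aemeasurable (by fun_prop)]
    congr with ω
    ring_nf
  rw [cgf, mgf, h1, integral_exp_neg_mul_sq_gaussianReal, Real.log_inv, Real.log_sqrt (by linarith)]
  ring_nf

variable [IsProbabilityMeasure P] {ξ : ℕ → Ω → ℝ} {lam : ℕ → ℝ}

theorem cgf_sum_mul_sq (hξ_law : ∀ n, HasLaw (ξ n) (gaussianReal 0 1) P) (hξ_indep : iIndepFun ξ P)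
    (hlam : ∀ n, 0 < lam n) (N : ℕ) {t : ℝ} (ht : t ≤ 0) :
    cgf (∑ n ∈ Finset.range N, fun ω => lam n * ξ n ω ^ 2) P t
      = -∑ n ∈ Finset.range N, Real.log (1 - 2 * t * lam n) / 2 := by
  have hm : ∀ n, AEMeasurable (fun ω => lam n * ξ n ω ^ 2) P := fun n => by
    have := (hξ_law n).aemeasurable
    fun_prop
  have hind : iIndepFun (fun n ω => lam n * ξ n ω ^ 2) P :=
    hξ_indep.comp (fun n x => lam n * x ^ 2) (fun n => by fun_prop)
  rw [hind.cgf_sum₀ hm, ← Finset.sum_neg_distrib]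
  · refine Finset.sum_congr rfl fun n _ => ?_
    refine cgf_mul_sq_of_hasLaw_gaussianReal (hξ_law n) ?_
    nlinarith [hlam n]
  · intro n _
    exact integrable_exp_mul_of_nonpos (hm n) (fun ω => mul_nonneg (hlam n).le (sq_nonneg _)) ht

theorem hasDerivAt_sum_log {ι : Type*} (s : Finset ι) {a : ι → ℝ} {t : ℝ}
    (h : ∀ i ∈ s, 0 < 1 - 2 * t * a i) :
    HasDerivAt (fun t => -∑ i ∈ s, Real.log (1 - 2 * t * a i) / 2)
      (∑ i ∈ s, a i / (1 - 2 * t * a i)) t := by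
  rw [← neg_neg (∑ i ∈ s, a i / (1 - 2 * t * a i)), ← Finset.sum_neg_distrib]
  refine (HasDerivAt.fun_sum fun i hi => ?_).neg
  have h1 : HasDerivAt (fun t : ℝ => 1 - 2 * t * a i) (-(2 * a i)) t := by
    have := (((hasDerivAt_id t).const_mul 2).mul_const (a i)).const_sub 1
    simpa using this
  convert! (h1.log (h i hi).ne').div_const 2 using 1
  ring

theorem hasDerivAt_sum_div {ι : Type*} (s : Finset ι) {a : ι → ℝ} {t : ℝ}
    (h : ∀ i ∈ s, 0 < 1 - 2 * t * a i) :
    HasDerivAt (fun t => ∑ i ∈ s, a i / (1 - 2 * t * a i))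
      (∑ i ∈ s, 2 * (a i / (1 - 2 * t * a i)) ^ 2) t := by
  refine HasDerivAt.fun_sum fun i hi => ?_
  have h1 : HasDerivAt (fun t : ℝ => 1 - 2 * t * a i) (-(2 * a i)) t := by
    have := (((hasDerivAt_id t).const_mul 2).mul_const (a i)).const_sub 1
    simpa using this
  convert! (hasDerivAt_const t (a i)).div h1 (h i hi).ne' using 1
  have := (h i hi).ne'
  field_simp
  ring

/-- The closed form is available for `t ≤ 0`; strict negativity makes it valid on a neighbourhood,
so it can be differentiated. -/
theorem deriv_cgf_sum_mul_sq (hξ_law : ∀ n, HasLaw (ξ n) (gaussianReal 0 1) P)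
    (hξ_indep : iIndepFun ξ P) (hlam : ∀ n, 0 < lam n) (N : ℕ) {t : ℝ} (ht : t < 0) :
    deriv (cgf (∑ n ∈ Finset.range N, fun ω => lam n * ξ n ω ^ 2) P) t
      = ∑ n ∈ Finset.range N, lam n / (1 - 2 * t * lam n) := by
  have h := hasDerivAt_sum_log (Finset.range N) (a := lam) (t := t)
    (fun n _ => by nlinarith [hlam n])
  refine (h.congr_of_eventuallyEq ?_).deriv
  filter_upwards [Iio_mem_nhds ht] with u hu
  exact cgf_sum_mul_sq hξ_law hξ_indep hlam N (le_of_lt hu)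

theorem iteratedDeriv_two_cgf_sum_mul_sq (hξ_law : ∀ n, HasLaw (ξ n) (gaussianReal 0 1) P)
    (hξ_indep : iIndepFun ξ P) (hlam : ∀ n, 0 < lam n) (N : ℕ) {t : ℝ} (ht : t < 0) :
    iteratedDeriv 2 (cgf (∑ n ∈ Finset.range N, fun ω => lam n * ξ n ω ^ 2) P) t
      = ∑ n ∈ Finset.range N, 2 * (lam n / (1 - 2 * t * lam n)) ^ 2 := by
  rw [iteratedDeriv_succ, iteratedDeriv_one]
  have h := hasDerivAt_sum_div (Finset.range N) (a := lam) (t := t)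
    (fun n _ => by nlinarith [hlam n])
  refine (h.congr_of_eventuallyEq ?_).deriv
  filter_upwards [Iio_mem_nhds ht] with u hu
  exact deriv_cgf_sum_mul_sq hξ_law hξ_indep hlam N hu

end LaplaceTransform

/-! ### Lower deviations by tilting -/

section Chernoff

variable {Ω : Type*} [MeasurableSpace Ω] {P : Measure Ω} [IsProbabilityMeasure P]

/-- Lower deviation bound by exponential tilting: if under the tilted measure `X` has mean at most
`m` and variance at most `σ ^ 2`, then `X ≤ r` is not much less likely than Chernoff's bound. -/
theorem le_measureReal_le_of_cgf {X : Ω → ℝ} (hX : AEMeasurable X P) (h0 : ∀ ω, 0 ≤ X ω)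
    {s σ r : ℝ} (hs : 0 < s) (hσ : 0 < σ)
    (hvar : iteratedDeriv 2 (cgf X P) (-s) ≤ σ ^ 2)
    (hr : deriv (cgf X P) (-s) + 2 * σ ≤ r) :
    3 / 4 * Real.exp (cgf X P (-s) + s * (deriv (cgf X P) (-s) - 2 * σ))
      ≤ P.real {ω | X ω ≤ r} := by
  set m := deriv (cgf X P) (-s) with hm
  set Q := P.tilted (fun ω => -s * X ω) with hQ
  have hint : Integrable (fun ω => Real.exp (-s * X ω)) P :=
    integrable_exp_mul_of_nonpos hX h0 (by linarith)
  have hmem : -s ∈ interior (integrableExpSet X P) := by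
    rw [mem_interior_iff_mem_nhds]
    filter_upwards [Iio_mem_nhds (show -s < 0 by linarith)] with t ht
    exact integrable_exp_mul_of_nonpos hX h0 (le_of_lt ht)
  have : IsProbabilityMeasure Q := isProbabilityMeasure_tilted hint
  have hL2 : MemLp X 2 Q := memLp_tilted_mul hmem 2
  have hmean : Q[X] = m := integral_tilted_mul_self hmem
  have hV : Var[X; Q] ≤ σ ^ 2 := (variance_tilted_mul hmem).le.trans hvar
  -- Chebyshev at two standard deviations, the source of the constant 3/4.
  have hcheb : Q.real {ω | 2 * σ ≤ |X ω - m|} ≤ 1 / 4 := by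
    have h1 := meas_ge_le_variance_div_sq hL2 (c := 2 * σ) (by positivity)
    rw [hmean] at h1
    have h2 : Var[X; Q] / (2 * σ) ^ 2 ≤ 1 / 4 := by
      rw [div_le_div_iff₀ (by positivity) (by norm_num)]
      nlinarith
    refine ENNReal.toReal_le_of_le_ofReal (by norm_num) (h1.trans (ENNReal.ofReal_le_ofReal h2))
  have hQX : AEMeasurable X Q := hX.mono_ac (tilted_absolutelyContinuous _ _)
  have hcompl : 3 / 4 ≤ Q.real {ω | |X ω - m| < 2 * σ} := by
    have h1 : Q.real {ω | 2 * σ ≤ |X ω - m|}ᶜ = 1 - Q.real {ω | 2 * σ ≤ |X ω - m|} :=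
      probReal_compl_eq_one_sub₀
        (nullMeasurableSet_le aemeasurable_const (by fun_prop))
    have h2 : {ω | 2 * σ ≤ |X ω - m|}ᶜ = {ω | |X ω - m| < 2 * σ} := by
      ext ω; simp
    rw [h2] at h1
    linarith
  -- On this event `X > m - 2 * σ`, which bounds the density of `Q` with respect to `P`.
  have hub : Q.real {ω | |X ω - m| < 2 * σ}
      ≤ Real.exp (-s * (m - 2 * σ) - cgf X P (-s)) * P.real {ω | |X ω - m| < 2 * σ} := by
    have h1 : Q {ω | |X ω - m| < 2 * σ}
        = ENNReal.ofReal (∫ ω in {ω | |X ω - m| < 2 * σ}, Real.exp (-s * X ω - cgf X P (-s)) ∂P) :=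
      tilted_mul_apply_eq_ofReal_integral_cgf _ hint
    have hS : NullMeasurableSet {ω | |X ω - m| < 2 * σ} P :=
      nullMeasurableSet_lt (by fun_prop) aemeasurable_const
    rw [Measure.real, h1, ENNReal.toReal_ofReal (by positivity)]
    have h3 : ∫ ω in {ω | |X ω - m| < 2 * σ}, Real.exp (-s * X ω - cgf X P (-s)) ∂P
        ≤ ∫ ω in {ω | |X ω - m| < 2 * σ}, Real.exp (-s * (m - 2 * σ) - cgf X P (-s)) ∂P := by
      refine setIntegral_mono_on₀ ?_ (integrable_const _).integrableOn hS fun ω hω => ?_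
      · have : (fun ω => Real.exp (-s * X ω - cgf X P (-s)))
            = fun ω => Real.exp (-s * X ω) * Real.exp (-cgf X P (-s)) := by
          ext ω; rw [← Real.exp_add]; ring_nf
        rw [this]
        exact (hint.mul_const _).integrableOn
      · have := (abs_lt.1 (show |X ω - m| < 2 * σ from hω)).1
        exact Real.exp_le_exp.2 (by nlinarith)
    refine h3.trans (le_of_eq ?_)
    rw [setIntegral_const, smul_eq_mul, mul_comm]
  have hsub : P.real {ω | |X ω - m| < 2 * σ} ≤ P.real {ω | X ω ≤ r} := by
    refine measureReal_mono fun ω hω => ?_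
    have := (abs_lt.1 (show |X ω - m| < 2 * σ from hω)).2
    simp only [Set.mem_ofPred_eq]
    linarith
  have hpos := Real.exp_pos (-s * (m - 2 * σ) - cgf X P (-s))
  have hfin : 3 / 4 ≤ Real.exp (-s * (m - 2 * σ) - cgf X P (-s)) * P.real {ω | X ω ≤ r} :=
    hcompl.trans (hub.trans (by gcongr))
  have : Real.exp (cgf X P (-s) + s * (m - 2 * σ))
      = (Real.exp (-s * (m - 2 * σ) - cgf X P (-s)))⁻¹ := by
    rw [← Real.exp_neg]; ring_nf
  rw [this, ← div_eq_mul_inv, div_le_iff₀ hpos]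
  linarith

end Chernoff

/-! ### Two-sided bounds for the small ball probability -/

theorem setOf_tsum_ofReal_le {Ω : Type*} {y : ℕ → Ω → ℝ} (hy : ∀ n ω, 0 ≤ y n ω) {r : ℝ} (hr : 0 ≤ r) :
    {ω | ∑' n, ENNReal.ofReal (y n ω) ≤ ENNReal.ofReal r}
      = ⋂ N : ℕ, {ω | (∑ n ∈ Finset.range N, y n) ω ≤ r} := by
  ext ω
  have key : ∀ N, ∑ n ∈ Finset.range N, ENNReal.ofReal (y n ω)
      = ENNReal.ofReal ((∑ n ∈ Finset.range N, y n) ω) := fun N => by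
    rw [Finset.sum_apply, ENNReal.ofReal_sum_of_nonneg fun n _ => hy n ω]
  simp only [Set.mem_ofPred_eq, Set.mem_iInter]
  constructor
  · intro h N
    rw [← ENNReal.ofReal_le_ofReal_iff hr, ← key]
    exact (ENNReal.sum_le_tsum _).trans h
  · intro h
    refine ENNReal.tsum_le_of_sum_range_le fun N => ?_
    rw [key]
    exact ENNReal.ofReal_le_ofReal (h N)

section SmallBall

variable {Ω : Type*} [MeasurableSpace Ω] {P : Measure Ω} [IsProbabilityMeasure P]
  {ξ : ℕ → Ω → ℝ} {lam : ℕ → ℝ}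

theorem smallBallProb_le_exp (hξ_law : ∀ n, HasLaw (ξ n) (gaussianReal 0 1) P)
    (hξ_indep : iIndepFun ξ P) (hlam : ∀ n, 0 < lam n)
    {s r L : ℝ} (hs : 0 ≤ s) (hr : 0 ≤ r)
    (hL : HasSum (fun n => Real.log (1 + s * lam n) / 2) L) :
    smallBallProb P ξ lam r ≤ Real.exp (s / 2 * r - L) := by
  have hN : ∀ N : ℕ, smallBallProb P ξ lam r
      ≤ Real.exp (s / 2 * r - ∑ n ∈ Finset.range N, Real.log (1 + s * lam n) / 2) := by
    intro N
    have hsub : smallBallProb P ξ lam r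
        ≤ P.real {ω | (∑ n ∈ Finset.range N, fun ω => lam n * ξ n ω ^ 2) ω ≤ r} := by
      refine measureReal_mono ?_
      rw [setOf_tsum_ofReal_le (y := fun n ω => lam n * ξ n ω ^ 2)
        (fun n ω => mul_nonneg (hlam n).le (sq_nonneg _)) hr]
      exact Set.iInter_subset _ N
    refine hsub.trans ((measure_le_le_exp_cgf (t := -(s / 2)) r (by linarith) ?_).trans ?_)
    · refine integrable_exp_mul_of_nonpos ?_ (fun ω => ?_) (by linarith)
      · refine Finset.aemeasurable_sum _ fun n _ => ?_
        have := (hξ_law n).aemeasurable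
        fun_prop
      · rw [Finset.sum_apply]
        exact Finset.sum_nonneg fun n _ => mul_nonneg (hlam n).le (sq_nonneg _)
    · rw [cgf_sum_mul_sq hξ_law hξ_indep hlam N (by linarith)]
      refine le_of_eq ?_
      congr 1
      rw [neg_neg, sub_eq_add_neg]
      congr 3 with n
      ring_nf
  exact ge_of_tendsto' ((Real.continuous_exp.tendsto _).comp
    (tendsto_const_nhds.sub hL.tendsto_sum_nat)) hN

theorem div_one_add_le_log_one_add {x : ℝ} (hx : 0 ≤ x) : x / (1 + x) ≤ Real.log (1 + x) := by
  have h1 := Real.one_sub_inv_le_log_of_pos (show 0 < 1 + x by linarith)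
  have h2 : x / (1 + x) = 1 - (1 + x)⁻¹ := by
    field_simp
    ring
  linarith

/-- The tilting bound is applied to partial sums with `σ = 2 * √A / s`, chosen independently of `N`;
continuity of `P` along the decreasing events then gives the series. -/
theorem le_smallBallProb (hξ_law : ∀ n, HasLaw (ξ n) (gaussianReal 0 1) P)
    (hξ_indep : iIndepFun ξ P) (hlam : ∀ n, 0 < lam n)
    {s r L A : ℝ} (hs : 0 < s) (hr : (A + 4 * √A) / s ≤ r)
    (hL : HasSum (fun n => Real.log (1 + s * lam n) / 2) L)
    (hA : HasSum (fun n => s * lam n / (1 + s * lam n)) A) :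
    3 / 4 * Real.exp (-(L - A / 2) - 2 * √A) ≤ smallBallProb P ξ lam r := by
  have hx : ∀ n, 0 < s * lam n := fun n => mul_pos hs (hlam n)
  have ha : ∀ n, 0 < s * lam n / (1 + s * lam n) := fun n => by
    have := hx n
    positivity
  have hApos : 0 < A := hA.tsum_eq ▸ hA.summable.tsum_pos (fun n => (ha n).le) 0 (ha 0)
  have hr0 : 0 ≤ r := le_trans (by positivity) hr
  have hy0 : ∀ n ω, 0 ≤ lam n * ξ n ω ^ 2 := fun n ω => mul_nonneg (hlam n).le (sq_nonneg _)
  have hym : ∀ n, AEMeasurable (fun ω => lam n * ξ n ω ^ 2) P := fun n => by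
    have := (hξ_law n).aemeasurable
    fun_prop
  have hSm : ∀ N, AEMeasurable (∑ n ∈ Finset.range N, fun ω => lam n * ξ n ω ^ 2) P := fun N =>
    Finset.aemeasurable_sum _ fun n _ => hym n
  have hN : ∀ N : ℕ, 3 / 4 * Real.exp (-(L - A / 2) - 2 * √A)
      ≤ P.real {ω | (∑ n ∈ Finset.range N, fun ω => lam n * ξ n ω ^ 2) ω ≤ r} := by
    intro N
    have hterm : ∀ n, lam n / (1 - 2 * -(s / 2) * lam n) = s * lam n / (1 + s * lam n) / s := by
      intro n
      have := hx n
      have h1 : 1 - 2 * -(s / 2) * lam n = 1 + s * lam n := by ring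
      rw [h1]
      field_simp
    have hAN : ∑ n ∈ Finset.range N, s * lam n / (1 + s * lam n) ≤ A :=
      sum_le_hasSum _ (fun n _ => (ha n).le) hA
    have hmean : deriv (cgf (∑ n ∈ Finset.range N, fun ω => lam n * ξ n ω ^ 2) P) (-(s / 2))
        = (∑ n ∈ Finset.range N, s * lam n / (1 + s * lam n)) / s := by
      rw [deriv_cgf_sum_mul_sq hξ_law hξ_indep hlam N (by linarith), Finset.sum_div]
      exact Finset.sum_congr rfl fun n _ => hterm n
    have hvar : iteratedDeriv 2 (cgf (∑ n ∈ Finset.range N, fun ω => lam n * ξ n ω ^ 2) P)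
        (-(s / 2)) ≤ (2 * √A / s) ^ 2 := by
      rw [iteratedDeriv_two_cgf_sum_mul_sq hξ_law hξ_indep hlam N (by linarith), div_pow, mul_pow,
        Real.sq_sqrt hApos.le]
      calc ∑ n ∈ Finset.range N, 2 * (lam n / (1 - 2 * -(s / 2) * lam n)) ^ 2
          ≤ ∑ n ∈ Finset.range N, 2 * (s * lam n / (1 + s * lam n)) / s ^ 2 := by
            refine Finset.sum_le_sum fun n _ => ?_
            rw [hterm, div_pow, ← mul_div_assoc]
            have h1 : s * lam n / (1 + s * lam n) ≤ 1 := by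
              have := hx n
              rw [div_le_one (by positivity)]
              linarith
            have := ha n
            gcongr
            nlinarith
        _ = 2 * (∑ n ∈ Finset.range N, s * lam n / (1 + s * lam n)) / s ^ 2 := by
            rw [← Finset.sum_div, Finset.mul_sum]
        _ ≤ 2 ^ 2 * A / s ^ 2 := by gcongr ?_ / _; linarith
    -- The difference has nonnegative terms, so its partial sums stay below the full sum.
    have hJN : ∑ n ∈ Finset.range N, (Real.log (1 + s * lam n) / 2 - s * lam n / (1 + s * lam n) / 2)
        ≤ L - A / 2 := by
      refine sum_le_hasSum _ (fun n _ => ?_) (hL.sub (hA.div_const 2))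
      linarith [div_one_add_le_log_one_add (hx n).le]
    rw [Finset.sum_sub_distrib, ← Finset.sum_div _ (fun n => s * lam n / (1 + s * lam n))] at hJN
    have hcgf : cgf (∑ n ∈ Finset.range N, fun ω => lam n * ξ n ω ^ 2) P (-(s / 2))
        = -∑ n ∈ Finset.range N, Real.log (1 + s * lam n) / 2 := by
      rw [cgf_sum_mul_sq hξ_law hξ_indep hlam N (by linarith)]
      congr 3 with n
      ring_nf
    refine le_trans ?_ (le_measureReal_le_of_cgf (hSm N) (fun ω => ?_) (half_pos hs)
      (div_pos (mul_pos two_pos (Real.sqrt_pos.2 hApos)) hs) hvar ?_)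
    · rw [hmean, hcgf]
      gcongr
      have : s / 2 * ((∑ n ∈ Finset.range N, s * lam n / (1 + s * lam n)) / s - 2 * (2 * √A / s))
          = (∑ n ∈ Finset.range N, s * lam n / (1 + s * lam n)) / 2 - 2 * √A := by
        field_simp
      rw [this]
      linarith
    · rw [Finset.sum_apply]
      exact Finset.sum_nonneg fun n _ => hy0 n ω
    · rw [hmean]
      refine le_trans (le_of_eq_of_le ?_ (div_le_div_of_nonneg_right
        (add_le_add_left hAN (4 * √A)) hs.le)) hr
      ring
  have hlim : Tendsto (fun N : ℕ =>
      P.real {ω | (∑ n ∈ Finset.range N, fun ω => lam n * ξ n ω ^ 2) ω ≤ r}) atTop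
      (𝓝 (smallBallProb P ξ lam r)) := by
    have hset := setOf_tsum_ofReal_le (y := fun n ω => lam n * ξ n ω ^ 2) hy0 hr0
    rw [smallBallProb, hset]
    refine (ENNReal.tendsto_toReal (measure_ne_top _ _)).comp
      (tendsto_measure_iInter_atTop (fun N => ?_) ?_ ⟨0, measure_ne_top _ _⟩)
    · exact nullMeasurableSet_le (hSm N) aemeasurable_const
    · intro M N hMN ω hω
      refine le_trans ?_ (show _ ≤ r from hω)
      simp only [Finset.sum_apply]
      exact Finset.sum_le_sum_of_subset_of_nonneg (Finset.range_mono hMN) fun n _ _ => hy0 n ω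
  exact ge_of_tendsto' hlim hN

end SmallBall

/-! ### Truncated sums as integrals of counting functions -/

section CountingFunction

theorem finite_setOf_lt_of_summable {y : ℕ → ℝ} (hy : Summable y) {t : ℝ} (ht : 0 < t) :
    {n | t < y n}.Finite := by
  have h := hy.tendsto_cofinite_zero.eventually (gt_mem_nhds ht)
  refine (eventually_cofinite.1 h).subset fun n hn => ?_
  simp only [Set.mem_ofPred_eq, not_lt] at hn ⊢
  exact hn.le

theorem countingFunction_nonneg (y : ℕ → ℝ) (t : ℝ) : 0 ≤ countingFunction y t :=
  Nat.cast_nonneg _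

theorem countingFunction_eq_tsum {y : ℕ → ℝ} (hy : Summable y) {t : ℝ} (ht : 0 < t) :
    countingFunction y t = ∑' n, (Set.Iio (y n)).indicator (fun _ => (1 : ℝ)) t := by
  have hfin := finite_setOf_lt_of_summable hy ht
  rw [tsum_eq_sum (s := hfin.toFinset), countingFunction, Set.ncard_eq_toFinset_card _ hfin,
    Finset.card_eq_sum_ones, Nat.cast_sum]
  · refine Finset.sum_congr rfl fun n hn => ?_
    rw [Set.indicator_of_mem]
    · simp
    · simpa using hn
  · intro n hn
    rw [Set.indicator_of_notMem]
    simpa using hn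

theorem setIntegral_indicator_Iio_one {a T : ℝ} (ha : 0 ≤ a) (hT : 0 ≤ T) :
    ∫ t in Set.Ioc 0 T, (Set.Iio a).indicator (fun _ => (1 : ℝ)) t = min a T := by
  rw [integral_congr_ae (g := (Set.Iic a).indicator (fun _ => (1 : ℝ)))
    (ae_restrict_of_ae (indicator_ae_eq_of_ae_eq_set Iio_ae_eq_Iic)),
    setIntegral_indicator measurableSet_Iic, Set.Ioc_inter_Iic, min_comm T a]
  simp [ha, hT]

theorem hasSum_min_intervalIntegral_countingFunction {y : ℕ → ℝ} (hy0 : ∀ n, 0 ≤ y n)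
    (hy : Summable y) {T : ℝ} (hT : 0 ≤ T) :
    HasSum (fun n => min (y n) T) (∫ t in (0 : ℝ)..T, countingFunction y t) := by
  have hint : ∀ n, Integrable ((Set.Iio (y n)).indicator (fun _ => (1 : ℝ)))
      (volume.restrict (Set.Ioc 0 T)) := fun n =>
    (integrable_const _).indicator measurableSet_Iio
  have h := hasSum_integral_of_summable_integral_norm hint (by
    refine Summable.of_nonneg_of_le (fun n => by positivity) (fun n => ?_) hy
    simp_rw [norm_indicator_eq_indicator_norm, norm_one]
    rw [setIntegral_indicator_Iio_one (hy0 n) hT]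
    exact min_le_left _ _)
  simp_rw [fun n => setIntegral_indicator_Iio_one (hy0 n) hT] at h
  rw [intervalIntegral.integral_of_le hT]
  convert! h using 1
  refine setIntegral_congr_fun measurableSet_Ioc fun t ht => ?_
  exact countingFunction_eq_tsum hy ht.1

theorem summable_min {y : ℕ → ℝ} (hy0 : ∀ n, 0 ≤ y n) (hy : Summable y) {T : ℝ} (hT : 0 ≤ T) :
    Summable fun n => min (y n) T :=
  (hasSum_min_intervalIntegral_countingFunction hy0 hy hT).summable

theorem tsum_min_le_of_countingFunction_le {y z : ℕ → ℝ} (hy0 : ∀ n, 0 ≤ y n) (hy : Summable y)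
    (hz0 : ∀ n, 0 < z n) (hz : Summable z) {T C : ℝ} (hT : 0 < T)
    (h : ∀ t, 0 < t → t < T → countingFunction y t ≤ C * countingFunction z t) :
    ∑' n, min (y n) T ≤ C * ∑' n, min (z n) T := by
  have hzs := hasSum_min_intervalIntegral_countingFunction (fun n => (hz0 n).le) hz hT.le
  rw [(hasSum_min_intervalIntegral_countingFunction hy0 hy hT.le).tsum_eq, hzs.tsum_eq]
  -- A nonzero Bochner integral forces integrability, needed for the monotonicity below.
  have hpos : 0 < ∫ t in (0 : ℝ)..T, countingFunction z t :=
    hzs.tsum_eq ▸ hzs.summable.tsum_pos (fun n => (lt_min (hz0 n) hT).le) 0 (lt_min (hz0 0) hT)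
  rw [intervalIntegral.integral_of_le hT.le, integral_Ioc_eq_integral_Ioo] at hpos
  simp_rw [intervalIntegral.integral_of_le hT.le, integral_Ioc_eq_integral_Ioo]
  rw [← integral_const_mul]
  refine integral_mono_of_nonneg (ae_of_all _ fun t => countingFunction_nonneg y t)
    ((Integrable.of_integral_ne_zero hpos.ne').const_mul C) ?_
  filter_upwards [ae_restrict_mem measurableSet_Ioo] with t ht
  exact h t ht.1 ht.2

theorem exists_mul_tsum_min_le_of_liminf {y : ℕ → ℝ} (hy0 : ∀ n, 0 < y n) (hy : Summable y) {h : ℝ}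
    (hh : 1 < h)
    (hreg : (1 : EReal) < liminf (fun x : ℝ =>
        (((∫ t in (0 : ℝ)..(h * x), countingFunction y t) /
          (∫ t in (0 : ℝ)..x, countingFunction y t) : ℝ) : EReal)) (𝓝[>] 0)) :
    ∃ c > 0, ∀ᶠ x in 𝓝[>] (0 : ℝ), (1 + c) * ∑' n, min (y n) x ≤ ∑' n, min (y n) (h * x) := by
  obtain ⟨q, hq1, hq⟩ := EReal.lt_iff_exists_real_btwn.1 hreg
  have hq1 : 1 < q := by exact_mod_cast hq1
  refine ⟨q - 1, by linarith, ?_⟩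
  filter_upwards [eventually_lt_of_lt_liminf hq, self_mem_nhdsWithin] with x hx hx0
  have hx0 : 0 < x := hx0
  have hx : q < _ := EReal.coe_lt_coe_iff.1 hx
  have hxs := hasSum_min_intervalIntegral_countingFunction (fun n => (hy0 n).le) hy hx0.le
  rw [hxs.tsum_eq, (hasSum_min_intervalIntegral_countingFunction (fun n => (hy0 n).le) hy
    (show 0 ≤ h * x by positivity)).tsum_eq]
  have hpos : 0 < ∫ t in (0 : ℝ)..x, countingFunction y t :=
    hxs.tsum_eq ▸ hxs.summable.tsum_pos (fun n => (lt_min (hy0 n) hx0).le) 0 (lt_min (hy0 0) hx0)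
  rw [lt_div_iff₀ hpos] at hx
  linarith

end CountingFunction

/-! ### Sums depending only on the counting function near zero -/

section Comparison

/-- The properties of `x / (1 + x)` and `log (1 + x) / 2` that make the sums `∑ f (s * lam n)`
depend, to first order as `s → ∞`, only on the counting function of `lam` near zero. -/
structure IsSlowProfile (f : ℝ → ℝ) : Prop where
  strictMonoOn : StrictMonoOn f (Set.Ici 0)
  continuousOn : ContinuousOn f (Set.Ici 0)
  zero : f 0 = 0
  le_self : ∀ x, 0 ≤ x → f x ≤ x
  doubling : ∀ a b : ℝ, 0 < a → 0 < b → ∀ᶠ s in atTop, f (s * a) ≤ 2 * f (s * b)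

variable {f : ℝ → ℝ} {lam lam' : ℕ → ℝ}

theorem IsSlowProfile.pos (hf : IsSlowProfile f) {x : ℝ} (hx : 0 < x) : 0 < f x :=
  hf.zero ▸ hf.strictMonoOn Set.self_mem_Ici hx.le hx

theorem IsSlowProfile.summable (hf : IsSlowProfile f) (hpos : ∀ n, 0 < lam n) (hsum : Summable lam)
    {s : ℝ} (hs : 0 < s) : Summable fun n => f (s * lam n) :=
  Summable.of_nonneg_of_le (fun n => (hf.pos (mul_pos hs (hpos n))).le)
    (fun n => hf.le_self _ (mul_pos hs (hpos n)).le) (hsum.mul_left s)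

theorem IsSlowProfile.tsum_pos (hf : IsSlowProfile f) (hpos : ∀ n, 0 < lam n) (hsum : Summable lam)
    {s : ℝ} (hs : 0 < s) : 0 < ∑' n, f (s * lam n) :=
  (hf.summable hpos hsum hs).tsum_pos (fun n => (hf.pos (mul_pos hs (hpos n))).le) 0
    (hf.pos (mul_pos hs (hpos 0)))

/-- By doubling, one term is eventually at most twice each of the first `k` terms of the sum, and
`k` is arbitrary. -/
theorem IsSlowProfile.isLittleO (hf : IsSlowProfile f) (hpos : ∀ n, 0 < lam n)
    (hsum : Summable lam) {a : ℝ} (ha : 0 < a) :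
    (fun s => f (s * a)) =o[atTop] fun s => ∑' n, f (s * lam n) := by
  refine isLittleO_iff.2 fun η hη => ?_
  obtain ⟨k, hk⟩ := exists_nat_gt (2 / η)
  have hev : ∀ᶠ s in atTop, ∀ n ∈ Finset.range k, f (s * a) ≤ 2 * f (s * lam n) :=
    (Filter.eventually_all_finset _).2 fun n _ => hf.doubling a (lam n) ha (hpos n)
  filter_upwards [hev, eventually_gt_atTop 0] with s hs hs0
  have h1 := hf.pos (mul_pos hs0 ha)
  rw [Real.norm_of_nonneg h1.le, Real.norm_of_nonneg (hf.tsum_pos hpos hsum hs0).le]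
  have h2 : ∑ n ∈ Finset.range k, f (s * lam n) ≤ ∑' n, f (s * lam n) :=
    (hf.summable hpos hsum hs0).sum_le_tsum _ fun n _ => (hf.pos (mul_pos hs0 (hpos n))).le
  have h3 : k * f (s * a) ≤ 2 * ∑ n ∈ Finset.range k, f (s * lam n) := by
    rw [Finset.mul_sum, ← nsmul_eq_mul]
    calc k • f (s * a) = ∑ n ∈ Finset.range k, f (s * a) := by simp
      _ ≤ _ := Finset.sum_le_sum hs
  rw [div_lt_iff₀ hη] at hk
  nlinarith

/-- Since `f` is strictly increasing, counting `f (s * lam n) > f x` is counting `lam n > x / s`. -/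
theorem IsSlowProfile.countingFunction_comp_le (hf : IsSlowProfile f) (hpos : ∀ n, 0 < lam n)
    (hpos' : ∀ n, 0 < lam' n) {C δ s : ℝ} (hs : 0 < s) (hδ : 0 < δ)
    (h : ∀ t, 0 < t → t < δ → countingFunction lam' t ≤ C * countingFunction lam t)
    (t : ℝ) (ht0 : 0 < t) (ht : t < f (s * δ)) :
    countingFunction (fun n => f (s * lam' n)) t
      ≤ C * countingFunction (fun n => f (s * lam n)) t := by
  have hsδ : 0 < s * δ := mul_pos hs hδ
  obtain ⟨x, hx, rfl⟩ : t ∈ f '' Set.Ioo 0 (s * δ) :=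
    intermediate_value_Ioo hsδ.le (hf.continuousOn.mono Set.Icc_subset_Ici_self)
      ⟨by rwa [hf.zero], ht⟩
  have key : ∀ z : ℕ → ℝ, (∀ n, 0 < z n) →
      countingFunction (fun n => f (s * z n)) (f x) = countingFunction z (x / s) := by
    intro z hz
    unfold countingFunction
    congr 3 with n
    rw [hf.strictMonoOn.lt_iff_lt hx.1.le (mul_pos hs (hz n)).le, div_lt_iff₀ hs, mul_comm]
  rw [key _ hpos', key _ hpos]
  exact h _ (div_pos hx.1 hs) (by rw [div_lt_iff₀ hs, mul_comm]; exact hx.2)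

/-- Truncate at `f (s * δ)`: the truncated sums compare through counting functions, and the excess
comes only from the finitely many `lam' n > δ`. -/
theorem IsSlowProfile.eventually_tsum_le (hf : IsSlowProfile f) (hpos : ∀ n, 0 < lam n)
    (hsum : Summable lam) (hpos' : ∀ n, 0 < lam' n) (hsum' : Summable lam')
    (h : ∀ ε > 0, ∀ᶠ t in 𝓝[>] (0 : ℝ), countingFunction lam' t ≤ (1 + ε) * countingFunction lam t)
    {ε : ℝ} (hε : 0 < ε) :
    ∀ᶠ s in atTop, ∑' n, f (s * lam' n) ≤ (1 + ε) * ∑' n, f (s * lam n) := by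
  obtain ⟨δ, hδ, hδ'⟩ := mem_nhdsGT_iff_exists_Ioo_subset.1 (h (ε / 2) (half_pos hε))
  have hδ0 : 0 < δ := hδ
  have hfin := finite_setOf_lt_of_summable hsum' hδ0
  have hrest : (fun s => ∑ n ∈ hfin.toFinset, f (s * lam' n))
      =o[atTop] fun s => ∑' n, f (s * lam n) :=
    IsLittleO.fun_sum fun n _ => hf.isLittleO hpos hsum (hpos' n)
  filter_upwards [isLittleO_iff.1 hrest (half_pos hε), eventually_gt_atTop 0] with s hs hs0
  have hp : ∀ n, 0 < f (s * lam n) := fun n => hf.pos (mul_pos hs0 (hpos n))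
  have hp' : ∀ n, 0 < f (s * lam' n) := fun n => hf.pos (mul_pos hs0 (hpos' n))
  have hS := hf.summable hpos hsum hs0
  have hS' := hf.summable hpos' hsum' hs0
  have hT := hf.pos (mul_pos hs0 hδ0)
  rw [Real.norm_of_nonneg (Finset.sum_nonneg fun n _ => (hp' n).le),
    Real.norm_of_nonneg (hf.tsum_pos hpos hsum hs0).le] at hs
  have h1 := tsum_min_le_of_countingFunction_le (fun n => (hp' n).le) hS' hp hS hT
    (hf.countingFunction_comp_le hpos hpos' hs0 hδ0 fun t ht0 ht => hδ' ⟨ht0, ht⟩)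
  have h2 : ∑' n, min (f (s * lam n)) (f (s * δ)) ≤ ∑' n, f (s * lam n) :=
    (summable_min (fun n => (hp n).le) hS hT.le).tsum_le_tsum (fun n => min_le_left _ _) hS
  have hmin := summable_min (fun n => (hp' n).le) hS' hT.le
  have h3 : ∑' n, (f (s * lam' n) - min (f (s * lam' n)) (f (s * δ)))
      ≤ ∑ n ∈ hfin.toFinset, f (s * lam' n) := by
    rw [tsum_eq_sum (s := hfin.toFinset)]
    · refine Finset.sum_le_sum fun n _ => ?_
      linarith [le_min (hp' n).le hT.le]
    · intro n hn
      have hn : lam' n ≤ δ := by simpa using hn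
      rw [min_eq_left, sub_self]
      exact hf.strictMonoOn.monotoneOn (mul_pos hs0 (hpos' n)).le (mul_pos hs0 hδ0).le (by gcongr)
  rw [hS'.tsum_sub hmin] at h3
  nlinarith

theorem IsSlowProfile.isEquivalent (hf : IsSlowProfile f) (hpos : ∀ n, 0 < lam n)
    (hsum : Summable lam) (hpos' : ∀ n, 0 < lam' n) (hsum' : Summable lam')
    (h : countingFunction lam ~[𝓝[>] 0] countingFunction lam') :
    (fun s => ∑' n, f (s * lam' n)) ~[atTop] fun s => ∑' n, f (s * lam n) := by
  have hev : ∀ {y z : ℕ → ℝ}, countingFunction y ~[𝓝[>] 0] countingFunction z →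
      ∀ ε > 0, ∀ᶠ t in 𝓝[>] (0 : ℝ), countingFunction y t ≤ (1 + ε) * countingFunction z t := by
    intro y z hyz ε hε
    filter_upwards [isLittleO_iff.1 hyz hε] with t ht
    rw [Pi.sub_apply, Real.norm_eq_abs, Real.norm_of_nonneg (countingFunction_nonneg z t)] at ht
    linarith [(abs_le.1 ht).2]
  refine isLittleO_iff.2 fun ε hε => ?_
  filter_upwards [hf.eventually_tsum_le hpos hsum hpos' hsum' (hev h.symm) hε,
    hf.eventually_tsum_le hpos' hsum' hpos hsum (hev h) hε,
    -- The crude factor 2 converts an error `ε / 2` relative to the `lam'` sum into `ε` relative to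
    -- the `lam` sum.
    hf.eventually_tsum_le hpos hsum hpos' hsum' (hev h.symm) one_pos,
    hf.eventually_tsum_le hpos' hsum' hpos hsum (hev h) (half_pos hε), eventually_gt_atTop 0]
    with s h1 h2 h3 h4 hs0
  have hp := hf.tsum_pos hpos hsum hs0
  rw [Pi.sub_apply, Real.norm_eq_abs, Real.norm_of_nonneg hp.le, abs_le]
  constructor
  · nlinarith
  · linarith

theorem isSlowProfile_div_one_add : IsSlowProfile fun x => x / (1 + x) where
  strictMonoOn := by
    intro x hx y hy hxy
    have hx : 0 ≤ x := hx
    have hy : 0 ≤ y := hy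
    simp only
    rw [div_lt_div_iff₀ (by positivity) (by positivity)]
    nlinarith
  continuousOn := by
    refine ContinuousOn.div (by fun_prop) (by fun_prop) fun x hx => ?_
    have hx : 0 ≤ x := hx
    positivity
  zero := by simp
  le_self x hx := div_le_self hx (by linarith)
  doubling a b ha hb := by
    filter_upwards [eventually_gt_atTop 0, eventually_ge_atTop (1 / b)] with s hs hsb
    rw [div_le_iff₀ hb] at hsb
    have h1 : s * a / (1 + s * a) ≤ 1 := by
      rw [div_le_one (by positivity)]
      linarith
    have h2 : 1 / 2 ≤ s * b / (1 + s * b) := by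
      rw [div_le_div_iff₀ (by norm_num) (by positivity)]
      linarith
    linarith

theorem isSlowProfile_log_one_add : IsSlowProfile fun x => Real.log (1 + x) / 2 where
  strictMonoOn := by
    intro x hx y hy hxy
    have hx : 0 ≤ x := hx
    have := Real.log_lt_log (show 0 < 1 + x by positivity) (show 1 + x < 1 + y by linarith)
    simp only
    linarith
  continuousOn := by
    refine ContinuousOn.div_const (ContinuousOn.log (by fun_prop) fun x hx => ?_) _
    have hx : 0 ≤ x := hx
    positivity
  zero := by simp
  le_self x hx := by
    have := Real.log_le_sub_one_of_pos (show 0 < 1 + x by positivity)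
    linarith
  doubling a b ha hb := by
    filter_upwards [eventually_gt_atTop 0, eventually_ge_atTop (a / b ^ 2)] with s hs hsb
    rw [div_le_iff₀ (by positivity)] at hsb
    have h1 : Real.log (1 + s * a) ≤ Real.log ((1 + s * b) ^ 2) := by
      refine Real.log_le_log (by positivity) ?_
      nlinarith [mul_pos hs hb]
    rw [Real.log_pow] at h1
    push_cast at h1
    linarith

end Comparison

/-! ### The saddle point functions and their growth -/

section SaddlePoint

/-- Minus the logarithm of the Laplace transform of `∑ lam n * ξ n ^ 2` at `s / 2`. -/
noncomputable def logSum (lam : ℕ → ℝ) (s : ℝ) : ℝ := ∑' n, Real.log (1 + s * lam n) / 2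

/-- `s` times the mean of `∑ lam n * ξ n ^ 2` under exponential tilting at `-s / 2`. -/
noncomputable def ratioSum (lam : ℕ → ℝ) (s : ℝ) : ℝ := ∑' n, s * lam n / (1 + s * lam n)

/-- The mean of `∑ lam n * ξ n ^ 2` under exponential tilting at `-s / 2`. -/
noncomputable def tiltedMean (lam : ℕ → ℝ) (s : ℝ) : ℝ := ∑' n, lam n / (1 + s * lam n)

variable {lam lam' : ℕ → ℝ}

theorem hasSum_logSum (hpos : ∀ n, 0 < lam n) (hsum : Summable lam) {s : ℝ} (hs : 0 < s) :
    HasSum (fun n => Real.log (1 + s * lam n) / 2) (logSum lam s) :=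
  (isSlowProfile_log_one_add.summable hpos hsum hs).hasSum

theorem hasSum_ratioSum (hpos : ∀ n, 0 < lam n) (hsum : Summable lam) {s : ℝ} (hs : 0 < s) :
    HasSum (fun n => s * lam n / (1 + s * lam n)) (ratioSum lam s) :=
  (isSlowProfile_div_one_add.summable hpos hsum hs).hasSum

theorem ratioSum_pos (hpos : ∀ n, 0 < lam n) (hsum : Summable lam) {s : ℝ} (hs : 0 < s) :
    0 < ratioSum lam s :=
  isSlowProfile_div_one_add.tsum_pos hpos hsum hs

theorem logSum_pos (hpos : ∀ n, 0 < lam n) (hsum : Summable lam) {s : ℝ} (hs : 0 < s) :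
    0 < logSum lam s :=
  isSlowProfile_log_one_add.tsum_pos hpos hsum hs

theorem ratioSum_le_two_mul_logSum (hpos : ∀ n, 0 < lam n) (hsum : Summable lam) {s : ℝ}
    (hs : 0 < s) : ratioSum lam s ≤ 2 * logSum lam s := by
  refine hasSum_le (fun n => ?_) (hasSum_ratioSum hpos hsum hs)
    ((hasSum_logSum hpos hsum hs).mul_left 2)
  linarith [div_one_add_le_log_one_add (mul_pos hs (hpos n)).le]

/-- The quantity `s / (1 + s)` stays above 1/2 yet is negligible against the sum. -/
theorem tendsto_ratioSum_atTop (hpos : ∀ n, 0 < lam n) (hsum : Summable lam) :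
    Tendsto (ratioSum lam) atTop atTop := by
  refine tendsto_atTop.2 fun b => ?_
  have hη : 0 < 1 / (2 * (|b| + 1)) := by positivity
  have ho := isSlowProfile_div_one_add.isLittleO hpos hsum one_pos
  filter_upwards [isLittleO_iff.1 ho hη, eventually_ge_atTop 1] with s hs hs1
  have h1 : 1 / 2 ≤ s * 1 / (1 + s * 1) := by
    rw [div_le_div_iff₀ (by norm_num) (by positivity)]
    linarith
  have h2 := ratioSum_pos hpos hsum (show 0 < s by linarith)
  have h3 : s * 1 / (1 + s * 1) ≤ 1 / (2 * (|b| + 1)) * ratioSum lam s := by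
    rwa [Real.norm_of_nonneg (by linarith), Real.norm_of_nonneg] at hs
    exact h2.le
  rw [div_mul_eq_mul_div, one_mul] at h3
  have h4 := h1.trans h3
  rw [div_le_div_iff₀ (by norm_num) (by positivity)] at h4
  linarith [le_abs_self b]

theorem tendsto_logSum_atTop (hpos : ∀ n, 0 < lam n) (hsum : Summable lam) :
    Tendsto (logSum lam) atTop atTop := by
  refine tendsto_atTop_mono' _ ?_ ((tendsto_ratioSum_atTop hpos hsum).atTop_div_const two_pos)
  filter_upwards [eventually_gt_atTop 0] with s hs
  linarith [ratioSum_le_two_mul_logSum hpos hsum hs]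

theorem ratioSum_mono (hpos : ∀ n, 0 < lam n) (hsum : Summable lam) {s t : ℝ} (hs : 0 < s)
    (hst : s ≤ t) : ratioSum lam s ≤ ratioSum lam t := by
  have ht : 0 < t := by linarith
  refine hasSum_le (fun n => ?_) (hasSum_ratioSum hpos hsum hs) (hasSum_ratioSum hpos hsum ht)
  exact isSlowProfile_div_one_add.strictMonoOn.monotoneOn (mul_pos hs (hpos n)).le
    (mul_pos ht (hpos n)).le (mul_le_mul_of_nonneg_right hst (hpos n).le)

/-- Bernoulli: `1 + h * x ≤ (1 + x) ^ h`. -/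
theorem logSum_mul_le (hpos : ∀ n, 0 < lam n) (hsum : Summable lam) {s h : ℝ} (hs : 0 < s)
    (hh : 1 ≤ h) : logSum lam (h * s) ≤ h * logSum lam s := by
  have hhs : 0 < h * s := by positivity
  refine hasSum_le (fun n => ?_) (hasSum_logSum hpos hsum hhs)
    ((hasSum_logSum hpos hsum hs).mul_left h)
  have hx := mul_pos hs (hpos n)
  have h1 := one_add_mul_self_le_rpow_one_add (s := s * lam n) (by linarith) hh
  have h2 := Real.log_le_log (by positivity) h1
  rw [Real.log_rpow (by positivity), ← mul_assoc] at h2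
  linarith

theorem summable_ratio_sq (hpos : ∀ n, 0 < lam n) (hsum : Summable lam) {s : ℝ} (hs : 0 < s) :
    Summable fun n => (s * lam n / (1 + s * lam n)) ^ 2 := by
  refine Summable.of_nonneg_of_le (fun n => sq_nonneg _) (fun n => ?_)
    (hasSum_ratioSum hpos hsum hs).summable
  have hx := mul_pos hs (hpos n)
  have h1 : s * lam n / (1 + s * lam n) ≤ 1 := by
    rw [div_le_one (by positivity)]
    linarith
  have h2 : 0 ≤ s * lam n / (1 + s * lam n) := by positivity
  nlinarith

/-- The subtracted term quantifies concavity; once it is comparable to `ratioSum`, the tilted mean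
drops by a fixed factor from `s` to `h * s`. -/
theorem ratioSum_mul_le (hpos : ∀ n, 0 < lam n) (hsum : Summable lam) {s h : ℝ} (hs : 0 < s)
    (hh : 1 ≤ h) : ratioSum lam (h * s)
      ≤ h * ratioSum lam s - (h - 1) * ∑' n, (s * lam n / (1 + s * lam n)) ^ 2 := by
  have hhs : 0 < h * s := by positivity
  refine hasSum_le (fun n => ?_) (hasSum_ratioSum hpos hsum hhs)
    (((hasSum_ratioSum hpos hsum hs).mul_left h).sub
      ((summable_ratio_sq hpos hsum hs).hasSum.mul_left (h - 1)))
  have hx := mul_pos hs (hpos n)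
  rw [mul_assoc h s]
  generalize s * lam n = x at hx
  have hd : 0 < 1 + x := by positivity
  have hd' : 0 < 1 + h * x := by positivity
  have h2 : h * (x / (1 + x)) - (h - 1) * (x / (1 + x)) ^ 2 - h * x / (1 + h * x)
      = (h - 1) ^ 2 * x ^ 2 / ((1 + x) ^ 2 * (1 + h * x)) := by
    field_simp
    ring
  have h3 : 0 ≤ (h - 1) ^ 2 * x ^ 2 / ((1 + x) ^ 2 * (1 + h * x)) := by positivity
  linarith

/-- Termwise from `log (1 + x) ≥ 2 * x / (x + 2)`; this limits the cancellation in the exponent. -/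
theorem tsum_ratio_sq_le (hpos : ∀ n, 0 < lam n) (hsum : Summable lam) {s : ℝ} (hs : 0 < s) :
    (∑' n, (s * lam n / (1 + s * lam n)) ^ 2) / 4 ≤ logSum lam s - ratioSum lam s / 2 := by
  refine hasSum_le (fun n => ?_) ((summable_ratio_sq hpos hsum hs).hasSum.div_const 4)
    ((hasSum_logSum hpos hsum hs).sub ((hasSum_ratioSum hpos hsum hs).div_const 2))
  have hx := mul_pos hs (hpos n)
  generalize s * lam n = x at hx
  have h1 := Real.le_log_one_add_of_nonneg hx.le
  have h2 : 2 * x / (x + 2) - x / (1 + x) - (x / (1 + x)) ^ 2 / 2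
      = x ^ 3 / (2 * (x + 2) * (1 + x) ^ 2) := by
    field_simp
    ring
  have h3 : 0 ≤ x ^ 3 / (2 * (x + 2) * (1 + x) ^ 2) := by positivity
  linarith

/-- With `x = s * lam n`, the increment `min x 2 - min x 1` vanishes for `x ≤ 1` and is at most `1 ≤
4 * (x / (1 + x)) ^ 2` otherwise, while `x / (1 + x) ≤ min x 1`. -/
theorem mul_ratioSum_le_tsum_ratio_sq (hpos : ∀ n, 0 < lam n) (hsum : Summable lam) {s c : ℝ}
    (hs : 0 < s) (hc : 0 ≤ c)
    (h : (1 + c) * ∑' n, min (lam n) s⁻¹ ≤ ∑' n, min (lam n) (2 * s⁻¹)) :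
    c / 4 * ratioSum lam s ≤ ∑' n, (s * lam n / (1 + s * lam n)) ^ 2 := by
  have hlam0 : ∀ n, 0 ≤ lam n := fun n => (hpos n).le
  have h1 := (summable_min hlam0 hsum (T := s⁻¹) (by positivity)).hasSum.mul_left s
  have h2 := (summable_min hlam0 hsum (T := 2 * s⁻¹) (by positivity)).hasSum.mul_left s
  have hmin : ∀ n, s * min (lam n) s⁻¹ = min (s * lam n) 1 := fun n => by
    rw [mul_min_of_nonneg _ _ hs.le, mul_inv_cancel₀ hs.ne']
  have hmin2 : ∀ n, s * min (lam n) (2 * s⁻¹) = min (s * lam n) 2 := fun n => by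
    rw [mul_min_of_nonneg _ _ hs.le, mul_left_comm, mul_inv_cancel₀ hs.ne', mul_one]
  have h3 := hasSum_le (fun n => ?_) (hasSum_ratioSum hpos hsum hs) h1
  · have h4 := hasSum_le (fun n => ?_) (h2.sub h1)
      ((summable_ratio_sq hpos hsum hs).hasSum.mul_left 4)
    · nlinarith
    · rw [hmin, hmin2]
      have hx := mul_pos hs (hpos n)
      generalize s * lam n = x at hx
      rcases le_total x 1 with hx1 | hx1
      · rw [min_eq_left hx1, min_eq_left (by linarith), sub_self]
        positivity
      · have h5 : 1 / 2 ≤ x / (1 + x) := by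
          rw [div_le_div_iff₀ (by norm_num) (by positivity)]
          linarith
        rw [min_eq_right hx1]
        nlinarith [min_le_right x 2]
  · rw [hmin]
    have hx := mul_pos hs (hpos n)
    refine le_min (div_le_self hx.le (by linarith)) ?_
    rw [div_le_one (by positivity)]
    linarith

theorem tiltedMean_eq (s : ℝ) (hs : s ≠ 0) : tiltedMean lam s = ratioSum lam s / s := by
  rw [tiltedMean, ratioSum, ← tsum_div_const]
  congr with n
  field_simp

theorem norm_div_one_add_le (hpos : ∀ n, 0 < lam n) {s : ℝ} (hs : 0 ≤ s) (n : ℕ) :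
    ‖lam n / (1 + s * lam n)‖ ≤ lam n := by
  have := mul_nonneg hs (hpos n).le
  have := hpos n
  rw [Real.norm_of_nonneg (by positivity)]
  exact div_le_self (by positivity) (by linarith)

theorem continuousOn_tiltedMean (hpos : ∀ n, 0 < lam n) (hsum : Summable lam) :
    ContinuousOn (tiltedMean lam) (Set.Ici 0) := by
  refine continuousOn_tsum (fun n => ?_) hsum fun n s hs => norm_div_one_add_le hpos hs n
  refine ContinuousOn.div (by fun_prop) (by fun_prop) fun s hs => ?_
  have := mul_nonneg (show 0 ≤ s from hs) (hpos n).le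
  positivity

theorem tendsto_tiltedMean_atTop (hpos : ∀ n, 0 < lam n) (hsum : Summable lam) :
    Tendsto (tiltedMean lam) atTop (𝓝 0) := by
  have h := tendsto_tsum_of_dominated_convergence (𝓕 := atTop)
    (f := fun (s : ℝ) n => lam n / (1 + s * lam n)) (g := fun _ => 0) hsum (fun n => ?_) ?_
  · rw [tsum_zero] at h
    exact h
  · exact Tendsto.div_atTop tendsto_const_nhds
      (tendsto_atTop_add_const_left _ _ (tendsto_id.atTop_mul_const (hpos n)))
  · filter_upwards [eventually_ge_atTop 0] with s hs n
    exact norm_div_one_add_le hpos hs n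

theorem tiltedMean_pos (hpos : ∀ n, 0 < lam n) (hsum : Summable lam) {s : ℝ} (hs : 0 ≤ s) :
    0 < tiltedMean lam s := by
  have h : ∀ n, 0 < lam n / (1 + s * lam n) := fun n => by
    have := mul_nonneg hs (hpos n).le
    have := hpos n
    positivity
  exact (Summable.of_norm_bounded hsum fun n => norm_div_one_add_le hpos hs n).tsum_pos
    (fun n => (h n).le) 0 (h 0)

/-- By the intermediate value theorem small `r` are attained at large `s`; this transfers
asymptotics from `s → ∞` to `r → 0+` without inverting the map. -/
theorem nhdsGT_zero_le_map_tiltedMean (hpos : ∀ n, 0 < lam n) (hsum : Summable lam) :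
    𝓝[>] 0 ≤ map (tiltedMean lam) atTop := by
  intro S hS
  obtain ⟨U, hU⟩ := mem_atTop_sets.1 (mem_map.1 hS)
  set V := max U 0
  have hV0 : 0 ≤ V := le_max_right _ _
  filter_upwards [Ioo_mem_nhdsGT (tiltedMean_pos hpos hsum hV0)] with r hr
  obtain ⟨W, hW, hVW⟩ := (((tendsto_tiltedMean_atTop hpos hsum).eventually (gt_mem_nhds hr.1)).and
    (eventually_ge_atTop V)).exists
  obtain ⟨s, hs, rfl⟩ := intermediate_value_Icc' hVW
    ((continuousOn_tiltedMean hpos hsum).mono fun x hx => hV0.trans hx.1)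
    (show r ∈ Set.Icc (tiltedMean lam W) (tiltedMean lam V) from ⟨le_of_lt hW, hr.2.le⟩)
  exact hU s ((le_max_left _ _).trans hs.1)

end SaddlePoint

/-! ### Matching the upper and lower exponents -/

section Asymptotics

variable {Ω : Type*} [MeasurableSpace Ω] {P : Measure Ω} [IsProbabilityMeasure P]
  {ξ : ℕ → Ω → ℝ} {lam lam' : ℕ → ℝ}

theorem eventually_abs_sub_le_of_isEquivalent {α : Type*} {l : Filter α} {f g : α → ℝ}
    (h : f ~[l] g) (hg : ∀ᶠ x in l, 0 < g x) {η : ℝ} (hη : 0 < η) :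
    ∀ᶠ x in l, |f x - g x| ≤ η * g x := by
  filter_upwards [isLittleO_iff.1 h hη, hg] with x hx hgx
  rwa [Real.norm_of_nonneg hgx.le] at hx

theorem sqrt_le_mul_of_le {a η : ℝ} (hη : 0 < η) (ha : 1 / η ^ 2 ≤ a) : √a ≤ η * a := by
  have h0 : 0 < a := lt_of_lt_of_le (by positivity) ha
  rw [Real.sqrt_le_left (by positivity)]
  rw [div_le_iff₀ (by positivity)] at ha
  nlinarith

/-- Ensures that the tilted mean at `h * s` plus two deviations stays below `r`. Capitals are values
at `s`, small letters at `h * s`, primes refer to `lam'`; `d` is the room left by concavity. -/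
theorem add_four_mul_sqrt_le {A a a' d h η : ℝ} (hA : 0 ≤ A) (hη0 : 0 ≤ η) (hη1 : η ≤ 1)
    (hd : 0 ≤ d) (hηd : 9 * η * h ≤ d) (ha' : 0 ≤ a') (hsqrt : √a' ≤ η * a')
    (haa' : a' ≤ (1 + η) * a) (haA : a ≤ (h - d) * A) : a' + 4 * √a' ≤ h * A := by
  have ha : 0 ≤ a := nonneg_of_mul_nonneg_right (ha'.trans haa') (by linarith)
  calc a' + 4 * √a' ≤ (1 + 4 * η) * a' := by linarith
    _ ≤ (1 + 4 * η) * ((1 + η) * a) := by gcongr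
    _ ≤ (1 + 9 * η) * a := by
      rw [← mul_assoc]
      exact mul_le_mul_of_nonneg_right (by nlinarith) ha
    _ ≤ (1 + 9 * η) * ((h - d) * A) := by gcongr
    _ ≤ h * A := by
      rw [← mul_assoc]
      refine mul_le_mul_of_nonneg_right ?_ hA
      nlinarith

/-- The 20 is 3 from `l'`, 1 from `a' / 2` and 16 from `2 * √a'`, in units of `κ * L`. -/
theorem lower_exponent_le {L A l a l' a' η κ : ℝ} (hL : 0 ≤ L) (hA : 0 ≤ A) (hAL : A ≤ 2 * L)
    (hAa : A ≤ a) (haA : a ≤ (1 + κ) * A) (hl : l ≤ (1 + κ) * L)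
    (hη0 : 0 ≤ η) (hηκ : η ≤ κ) (hκ1 : κ ≤ 1) (hsqrt : √a' ≤ η * a')
    (ha' : |a' - a| ≤ η * a) (hl' : |l' - l| ≤ η * l) :
    -(L - A / 2) - 20 * (κ * L) ≤ -(l' - a' / 2) - 2 * √a' := by
  have hκ0 : 0 ≤ κ := hη0.trans hηκ
  have hκL : 0 ≤ κ * L := mul_nonneg hκ0 hL
  have hκκ : κ * (κ * L) ≤ κ * L := mul_le_of_le_one_left hκL hκ1
  have ha2 : a ≤ 4 * L := by
    have := mul_le_mul_of_nonneg_right hκ1 hA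
    linarith
  have ha8 : a' ≤ 8 * L := by
    have := mul_le_mul_of_nonneg_right (hηκ.trans hκ1) (hA.trans hAa)
    linarith [(abs_le.1 ha').2]
  have hsq : √a' ≤ 8 * (κ * L) := by
    have h1 : η * a' ≤ η * (8 * L) := mul_le_mul_of_nonneg_left ha8 hη0
    have h2 : η * L ≤ κ * L := mul_le_mul_of_nonneg_right hηκ hL
    linarith
  have h1 : (1 + η) * l ≤ (1 + κ) * ((1 + κ) * L) :=
    (mul_le_mul_of_nonneg_left hl (by linarith)).trans
      (mul_le_mul_of_nonneg_right (by linarith) (by positivity))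
  have h2 : (1 - η) * A ≤ (1 - η) * a := mul_le_mul_of_nonneg_left hAa (by linarith)
  have h3 : η * A ≤ κ * (2 * L) := mul_le_mul hηκ hAL hA hκ0
  linarith [(abs_le.1 ha').1, (abs_le.1 hl').2]

/-- The saddle point asymptotics of the small ball probability for `lam'`, expressed through any
sequence `lam` with an equivalent counting function. -/
theorem log_smallBallProb_tiltedMean_isEquivalent
    (hξ_law : ∀ n, HasLaw (ξ n) (gaussianReal 0 1) P) (hξ_indep : iIndepFun ξ P)
    (hpos : ∀ n, 0 < lam n) (hsum : Summable lam) (hpos' : ∀ n, 0 < lam' n)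
    (hsum' : Summable lam')
    (hreg : ∃ c > 0, ∀ᶠ x in 𝓝[>] (0 : ℝ),
      (1 + c) * ∑' n, min (lam n) x ≤ ∑' n, min (lam n) (2 * x))
    (hequiv : countingFunction lam ~[𝓝[>] 0] countingFunction lam') :
    (fun s => Real.log (smallBallProb P ξ lam' (tiltedMean lam s))) ~[atTop]
      fun s => -(logSum lam s - ratioSum lam s / 2) := by
  obtain ⟨c₀, hc₀, hreg⟩ := hreg
  set c := c₀ / 4
  have hc : 0 < c := by positivity
  have hregB : ∀ᶠ s in atTop, c * ratioSum lam s
      ≤ ∑' n, (s * lam n / (1 + s * lam n)) ^ 2 := by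
    filter_upwards [tendsto_inv_atTop_nhdsGT_zero.eventually hreg, eventually_gt_atTop 0]
      with s hs hs0
    exact mul_ratioSum_le_tsum_ratio_sq hpos hsum hs0 hc₀.le hs
  have hA' : ratioSum lam' ~[atTop] ratioSum lam :=
    isSlowProfile_div_one_add.isEquivalent hpos hsum hpos' hsum' hequiv
  have hL' : logSum lam' ~[atTop] logSum lam :=
    isSlowProfile_log_one_add.isEquivalent hpos hsum hpos' hsum' hequiv
  have hApos : ∀ᶠ s in atTop, 0 < ratioSum lam s :=
    (eventually_gt_atTop 0).mono fun s hs => ratioSum_pos hpos hsum hs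
  have hLpos : ∀ᶠ s in atTop, 0 < logSum lam s :=
    (eventually_gt_atTop 0).mono fun s hs => logSum_pos hpos hsum hs
  -- From `c * A ≤ B ≤ 4 * J` one gets `L = J + A / 2 ≤ K * J`.
  set K := 1 + 2 / c
  have hK : 0 < K := by positivity
  refine isLittleO_iff.2 fun ε hε => ?_
  -- The 21 is the 20 of `lower_exponent_le` plus 1 for `log (3 / 4) ≥ -1 ≥ -κ * L`.
  obtain ⟨κ, hκ0, hκ1, hκ⟩ : ∃ κ > 0, κ ≤ 1 ∧ 21 * κ * K ≤ ε := by
    refine ⟨min 1 (ε / (21 * K)), lt_min one_pos (by positivity), min_le_left _ _, ?_⟩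
    have h1 : min 1 (ε / (21 * K)) ≤ ε / (21 * K) := min_le_right _ _
    rw [le_div_iff₀ (by positivity)] at h1
    linarith
  set h := 1 + κ with hh
  obtain ⟨η, hη0, hηκ, hη⟩ : ∃ η > 0, η ≤ κ ∧ 9 * η * h ≤ (h - 1) * c := by
    have hh1 : 0 < h - 1 := by simp [hh, hκ0]
    have hh0 : 0 < h := by positivity
    refine ⟨min κ ((h - 1) * c / (9 * h)), lt_min hκ0 (by positivity), min_le_left _ _, ?_⟩
    have h1 : min κ ((h - 1) * c / (9 * h)) ≤ (h - 1) * c / (9 * h) := min_le_right _ _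
    rw [le_div_iff₀ (by positivity)] at h1
    linarith
  have hhtop : Tendsto (fun s : ℝ => h * s) atTop atTop :=
    tendsto_id.const_mul_atTop (by positivity)
  filter_upwards [hregB, eventually_gt_atTop 0,
    eventually_abs_sub_le_of_isEquivalent hL' hLpos hη0,
    hhtop.eventually (eventually_abs_sub_le_of_isEquivalent hL' hLpos hη0),
    hhtop.eventually (eventually_abs_sub_le_of_isEquivalent hA' hApos hη0),
    hhtop.eventually ((tendsto_ratioSum_atTop hpos' hsum').eventually_ge_atTop (1 / η ^ 2)),
    (tendsto_logSum_atTop hpos hsum).eventually_ge_atTop (1 / κ)]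
    with s hB hs hLs hLhs hAhs hAlarge hLlarge
  have hhs : 0 < h * s := by positivity
  have hh1 : 1 ≤ h := by simp [hh, hκ0.le]
  have hJ := tsum_ratio_sq_le hpos hsum hs
  have hAL := ratioSum_le_two_mul_logSum hpos hsum hs
  have hA0 := ratioSum_pos hpos hsum hs
  have hL0 := logSum_pos hpos hsum hs
  have hAh0' := ratioSum_pos hpos' hsum' hhs
  have hAmono := ratioSum_mono hpos hsum hs (show s ≤ h * s by nlinarith)
  have hAmul := ratioSum_mul_le hpos hsum hs hh1
  have hLmul := logSum_mul_le hpos hsum hs hh1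
  have hupper := smallBallProb_le_exp hξ_law hξ_indep hpos' hs.le
    (tiltedMean_pos hpos hsum hs.le).le (hasSum_logSum hpos' hsum' hs)
  have hsm : s / 2 * tiltedMean lam s = ratioSum lam s / 2 := by
    rw [tiltedMean_eq s hs.ne']
    field_simp
  rw [hsm] at hupper
  have hlower := fun hr => le_smallBallProb hξ_law hξ_indep hpos' (r := tiltedMean lam s) hhs hr
    (hasSum_logSum hpos' hsum' hhs) (hasSum_ratioSum hpos' hsum' hhs)
  rw [tiltedMean_eq s hs.ne', div_le_div_iff₀ hhs hs] at hlower
  rw [← tiltedMean_eq s hs.ne'] at hlower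
  have hη1 : η ≤ 1 := hηκ.trans hκ1
  have hsqrt := sqrt_le_mul_of_le hη0 hAlarge
  have hAh' := (abs_le.1 hAhs).2
  have hh0 : 0 ≤ h - 1 := by linarith
  have hBh := mul_le_mul_of_nonneg_left hB hh0
  have hB0 : 0 ≤ (h - 1) * (c * ratioSum lam s) := by positivity
  specialize hlower (by
    rw [← mul_assoc]
    refine mul_le_mul_of_nonneg_right ?_ hs.le
    rw [mul_comm _ h]
    exact add_four_mul_sqrt_le (a := ratioSum lam (h * s)) hA0.le hη0.le hη1 (mul_nonneg hh0 hc.le) hη hAh0'.le hsqrt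
      (by linarith) (by linarith))
  have hp := lt_of_lt_of_le (by positivity) hlower
  have hlogu := (Real.log_le_iff_le_exp hp).2 hupper
  have hlogl := Real.log_le_log (by positivity) hlower
  rw [Real.log_mul (by norm_num) (Real.exp_pos _).ne', Real.log_exp] at hlogl
  have hexp := lower_exponent_le hL0.le hA0.le hAL hAmono (by linarith) (by linarith) hη0.le hηκ hκ1
    hsqrt hAhs hLhs
  have hlog34 : -1 ≤ Real.log (3 / 4) := by
    have := Real.one_sub_inv_le_log_of_pos (show (0 : ℝ) < 3 / 4 by norm_num)
    norm_num at this
    linarith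
  have hκL : 1 ≤ logSum lam s * κ := (div_le_iff₀ hκ0).1 hLlarge
  have hLK : logSum lam s ≤ K * (logSum lam s - ratioSum lam s / 2) := by
    have h1 : ratioSum lam s ≤ 4 / c * (logSum lam s - ratioSum lam s / 2) := by
      rw [div_mul_eq_mul_div, le_div_iff₀ hc]
      linarith
    have h2 : K * (logSum lam s - ratioSum lam s / 2)
        = logSum lam s - ratioSum lam s / 2
          + 4 / c * (logSum lam s - ratioSum lam s / 2) / 2 := by
      ring
    linarith
  have hJ0 : 0 ≤ logSum lam s - ratioSum lam s / 2 := by linarith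
  have h1 := mul_le_mul_of_nonneg_left hLK (show 0 ≤ 21 * κ by positivity)
  have h2 := mul_le_mul_of_nonneg_right hκ hJ0
  have hηL := mul_le_mul_of_nonneg_right hηκ hL0.le
  rw [Pi.sub_apply, Real.norm_eq_abs, norm_neg, Real.norm_of_nonneg hJ0, sub_neg_eq_add, abs_le]
  constructor
  · linarith
  · have := (abs_le.1 hLs).1
    linarith

end Asymptotics

theorem theorem1 {Ω : Type*} [MeasurableSpace Ω] (P : Measure Ω) [IsProbabilityMeasure P]
    (ξ : ℕ → Ω → ℝ) (hξ_law : ∀ n, HasLaw (ξ n) (gaussianReal 0 1) P) (hξ_indep : iIndepFun ξ P)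
    (lam lam' : ℕ → ℝ)
    (hlam_pos : ∀ n, 0 < lam n) (hlam_sum : Summable lam)
    (hlam'_pos : ∀ n, 0 < lam' n) (hlam'_sum : Summable lam')
    (hreg : ∀ h : ℝ, 1 < h →
      (1 : EReal) < liminf (fun x : ℝ =>
        (((∫ t in (0 : ℝ)..(h * x), countingFunction lam t) /
          (∫ t in (0 : ℝ)..x, countingFunction lam t) : ℝ) : EReal)) (𝓝[>] 0))
    (hequiv : countingFunction lam ~[𝓝[>] 0] countingFunction lam') :
    (fun r => Real.log (smallBallProb P ξ lam' r)) ~[𝓝[>] 0]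
      (fun r => Real.log (smallBallProb P ξ lam r)) := by
  have hmin := exists_mul_tsum_min_le_of_liminf hlam_pos hlam_sum one_lt_two (hreg 2 one_lt_two)
  have h' := log_smallBallProb_tiltedMean_isEquivalent hξ_law hξ_indep hlam_pos hlam_sum
    hlam'_pos hlam'_sum hmin hequiv
  -- The case `lam' = lam` gives the same saddle point expression.
  have h := log_smallBallProb_tiltedMean_isEquivalent hξ_law hξ_indep hlam_pos hlam_sum
    hlam_pos hlam_sum hmin IsEquivalent.refl
  have hcomp := h'.trans h.symm
  refine IsLittleO.mono ?_ (nhdsGT_zero_le_map_tiltedMean hlam_pos hlam_sum)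
  exact isLittleO_map.2 hcomp
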